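/- **Definitions.** A metric space $X$ is *geodesic* if any two points $x,y$ are joined by an isometric image of $[0,d(x,y)]$. Let $\varepsilon>0$. An *$\varepsilon$-chain* is a finite sequence $\{x_0,\dots,x_n\}$ in $X$ with $d(x_i,x_{i+1})<\varepsilon$ for all $i$; it is an *$\varepsilon$-loop* if $x_0=x_n$. Two $\varepsilon$-chains with the same endpoints are *$\varepsilon$-homotopic* if one is obtained from the other by finitely many steps, each adding or removing a single point, such that all intermediate sequences are $\varepsilon$-chains with the same endpoints. An $\varepsilon$-loop is *$\varepsilon$-null* if it is $\varepsilon$-homotopic to $\{x_0\}$. Two $\varepsilon$-loops $\lambda_1,\lambda_2$ are *freely $\varepsilon$-homotopic* if there are $\varepsilon$-chains $\alpha,\beta$ with a common first point, ending at the starting points of $\lambda_1,\lambda_2$ respectively, such that $\alpha*\lambda_1*\overline{\alpha}$ is $\varepsilon$-homotopic to $\beta*\lambda_2*\overline{\beta}$ (here $*$ is concatenation and the bar is reversal). A number $\varepsilon>0$ is a *homotopy critical value* of $X$ if there is an $\varepsilon$-loop that is not $\varepsilon$-null but is $\delta$-null for every $\delta>\varepsilon$; the set of these values is the *homotopy critical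 spectrum* of $X$. An *$\varepsilon$-triad* is a triple $T=\{x_0,x_1,x_2\}$ with $d(x_i,x_j)=\varepsilon$ for $i\ne j$; put $\alpha_T=\{x_0,x_1,x_2,x_0\}$. A *midpoint refinement* of a sequence is obtained by inserting a midpoint between each point and its successor. $T$ is *essential* if some midpoint refinement of $\alpha_T$ is not $\varepsilon$-null. Essential $\varepsilon$-triads $T_1,T_2$ are *equivalent* if a midpoint refinement of $\alpha_{T_1}$ is freely $\varepsilon$-homotopic to a midpoint refinement of $\alpha_{T_2}$ or of $\overline{\alpha_{T_2}}$. The *multiplicity* of a homotopy critical value $\varepsilon$ is the number of non-equivalent essential $\varepsilon$-triads, i.e. the supremum of the cardinalities of sets of pairwise non-equivalent essential $\varepsilon$-triads. **Theorem.** Let $\mathcal X$ be a Gromov–Hausdorff precompact collection of (nonempty) compact geodesic spaces, i.e. the set of their isometry classes has compact closure in the Gromov–Hausdorff space of all nonempty compact metric spaces. For every $a>0$ there is a natural number $N$ such that for every $X\in\mathcal X$ the number of homotopy critical values of $X$ greater than $a$, counted with multiplicity (that is, the sum of their multiplicities), is at most $N$. Here the multiplicity of every homotopy critical value of a compact geodesic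 space is at least $1$. In particular, the homotopy critical spectrum of any compact geodesic space is discrete in $(0,\infty)$: it has no accumulation point in $(0,\infty)$. -/

import Mathlib

namespace DiscreteHomotopy

variable {X : Type*} [MetricSpace X]

/-- A geodesic space: any two points are joined by an arclength parameterized, distance realizing
curve, i.e. by an isometric image of the interval `[0, dist x y]`. -/
def IsGeodesicSpace (X : Type*) [MetricSpace X] : Prop :=
  ∀ x y : X, ∃ γ : ℝ → X, γ 0 = x ∧ γ (dist x y) = y ∧
    ∀ s ∈ Set.Icc (0 : ℝ) (dist x y), ∀ t ∈ Set.Icc (0 : ℝ) (dist x y),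
      dist (γ s) (γ t) = |s - t|

/-- An `ε`-chain: a finite nonempty sequence of points `x₀, …, xₙ` with consecutive distances
less than `ε`. -/
def IsEpsChain (ε : ℝ) (α : List X) : Prop :=
  α ≠ [] ∧ α.IsChain (fun x y => dist x y < ε)

/-- An `ε`-loop: an `ε`-chain whose first and last points agree. -/
def IsEpsLoop (ε : ℝ) (α : List X) : Prop :=
  IsEpsChain ε α ∧ α.head? = α.getLast?

/-- `β` arises from `α` by adding a single point. -/
def AddsPoint (α β : List X) : Prop :=
  ∃ (l r : List X) (x : X), α = l ++ r ∧ β = l ++ x :: r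

/-- A basic move between `ε`-chains with the same endpoints: add or remove a single point. -/
def BasicMove (ε : ℝ) (α β : List X) : Prop :=
  IsEpsChain ε α ∧ IsEpsChain ε β ∧ α.head? = β.head? ∧ α.getLast? = β.getLast? ∧
    (AddsPoint α β ∨ AddsPoint β α)

/-- `ε`-homotopy of `ε`-chains (with fixed endpoints): a finite sequence of basic moves. -/
def EpsHomotopic (ε : ℝ) (α β : List X) : Prop :=
  IsEpsChain ε α ∧ Relation.ReflTransGen (BasicMove ε) α β

/-- `ε`-null: `ε`-homotopic to a constant chain `{x₀}`.
(Basic moves preserve endpoints, so such a chain is a loop at `x₀`.) -/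
def IsEpsNull (ε : ℝ) (α : List X) : Prop :=
  ∃ x : X, EpsHomotopic ε α [x]

/-- An `ε`-critical `ε`-loop: not `ε`-null, but `δ`-null for every `δ > ε`. -/
def IsEpsCritical (ε : ℝ) (α : List X) : Prop :=
  IsEpsLoop ε α ∧ ¬ IsEpsNull ε α ∧ ∀ δ : ℝ, ε < δ → IsEpsNull δ α

/-- The homotopy critical spectrum: the set of homotopy critical values, that is of all `ε > 0`
for which there is an `ε`-critical `ε`-loop. -/
def criticalSpectrum (X : Type*) [MetricSpace X] : Set ℝ :=
  {ε : ℝ | 0 < ε ∧ ∃ α : List X, IsEpsCritical ε α}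

/-- Concatenation `{x₀, …, xₙ} * {xₙ = y₀, …, yₘ}` (used only when the endpoints match). -/
def concat (α β : List X) : List X := α ++ β.tail

/-- Free `ε`-homotopy of `ε`-loops: there are `ε`-chains `α`, `β` from a common point to the start
of `l₁`, resp. `l₂`, such that `α * l₁ * α⁻¹` is `ε`-homotopic to `β * l₂ * β⁻¹`. -/
def FreelyEpsHomotopic (ε : ℝ) (l₁ l₂ : List X) : Prop :=
  IsEpsLoop ε l₁ ∧ IsEpsLoop ε l₂ ∧
  ∃ α β : List X, IsEpsChain ε α ∧ IsEpsChain ε β ∧ α.head? = β.head? ∧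
    α.getLast? = l₁.head? ∧ β.getLast? = l₂.head? ∧
    EpsHomotopic ε (concat (concat α l₁) α.reverse) (concat (concat β l₂) β.reverse)

/-- `IsMidpointRefinement α β`: the chain `β` is obtained from `α` by inserting a (metric) midpoint
between each point and its successor. -/
inductive IsMidpointRefinement : List X → List X → Prop
  | single (x : X) : IsMidpointRefinement [x] [x]
  | cons (x m y : X) (α β : List X) (hx : dist x m = dist x y / 2) (hy : dist m y = dist x y / 2)
      (h : IsMidpointRefinement (y :: α) β) : IsMidpointRefinement (x :: y :: α) (x :: m :: β)

/-- The sequence `{x₀, x₁, x₂, x₀}` attached to a triple. -/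
def triadLoop (T : X × X × X) : List X := [T.1, T.2.1, T.2.2, T.1]

/-- An `ε`-triad: three points with all mutual distances equal to `ε > 0`. -/
def IsTriad (ε : ℝ) (T : X × X × X) : Prop :=
  0 < ε ∧ dist T.1 T.2.1 = ε ∧ dist T.2.1 T.2.2 = ε ∧ dist T.1 T.2.2 = ε

/-- An essential `ε`-triad: some midpoint refinement of its loop is not `ε`-null. -/
def IsEssentialTriad (ε : ℝ) (T : X × X × X) : Prop :=
  IsTriad ε T ∧ ∃ α : List X, IsMidpointRefinement (triadLoop T) α ∧ ¬ IsEpsNull ε α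

/-- Equivalence of essential `ε`-triads: a midpoint refinement of the loop of `T₁` is freely
`ε`-homotopic to a midpoint refinement of the loop of `T₂` or of its reversal. -/
def TriadEquiv (ε : ℝ) (T₁ T₂ : X × X × X) : Prop :=
  ∃ α β : List X, IsMidpointRefinement (triadLoop T₁) α ∧
    (IsMidpointRefinement (triadLoop T₂) β ∨ IsMidpointRefinement (triadLoop T₂).reverse β) ∧
    FreelyEpsHomotopic ε α β

/-- The multiplicity of `ε`: the number of non-equivalent essential `ε`-triads, that is, the
supremum of the cardinalities of sets of pairwise non-equivalent essential `ε`-triads. -/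
noncomputable def multiplicity (X : Type*) [MetricSpace X] (ε : ℝ) : ℕ∞ :=
  ⨆ S : {S : Set (X × X × X) // (∀ T ∈ S, IsEssentialTriad ε T) ∧
    S.Pairwise (fun T₁ T₂ => ¬ TriadEquiv ε T₁ T₂)}, S.1.encard

/-- The number of homotopy critical values greater than `a`, counted with multiplicity: the
(possibly infinite) sum of the multiplicities of these values, as a supremum of finite sums. -/
noncomputable def criticalCount (X : Type*) [MetricSpace X] (a : ℝ) : ℕ∞ :=
  ⨆ F : {F : Finset ℝ // ∀ ε ∈ F, ε ∈ criticalSpectrum X ∧ a < ε}, ∑ ε ∈ F.1, multiplicity X ε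

/-- A collection of nonempty compact metric spaces is Gromov-Hausdorff precompact if the set of
their isometry classes has compact closure in the Gromov-Hausdorff space. -/
def IsGHPrecompact {ι : Type*} (X : ι → Type*) [∀ i, MetricSpace (X i)]
    [∀ i, CompactSpace (X i)] [∀ i, Nonempty (X i)] : Prop :=
  IsCompact (closure (Set.range fun i => GromovHausdorff.toGHSpace (X i)))

end DiscreteHomotopy

/-!
Refining a chain by midpoints halves its steps. If every triangle with sides less than some `δ > ε`
has an `ε`-null midpoint refinement, then refining a `δ`-null-homotopy move by move shows that
`δ`-null `ε`-chains are `ε`-null. At a critical value `ε` there are therefore triangles with sides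
arbitrarily little above `ε` whose refinements are not `ε`-null. Refinements of two triangles with
sides at most `9ε/8` and vertices closer than `ε/8` are freely `ε`-homotopic, so by compactness such
a triangle exists with sides at most `ε`. If one of its sides were less than `ε`, it would be a
limit of triangles with all sides less than `ε`, whose refinements are `ε`-null; so it is an
essential triad.

By the same closeness statement, essential triads which are close to each other have the same size
and are equivalent. So a partition of `X` into `n` pieces of diameter less than `a/8` leaves room
for at most `n³` inequivalent ones of size greater than `a`, and `n` is uniform on a precompact
collection.
-/

namespace DiscreteHomotopy

theorem AddsPoint.congr {X : Type*} {α β : List X} (h : AddsPoint α β) (l r : List X) :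
    AddsPoint (l ++ α ++ r) (l ++ β ++ r) := by
  obtain ⟨l', r', x, rfl, rfl⟩ := h
  exact ⟨l ++ l', r' ++ r, x, by simp, by simp⟩

section Homotopy

variable {X : Type*} [MetricSpace X] {ε : ℝ} {α β γ l r : List X} {a b x y : X}

theorem IsEpsChain.congr (h : IsEpsChain ε (l ++ α ++ r)) (hα : α ≠ []) (hβ : IsEpsChain ε β)
    (hhead : α.head? = β.head?) (hlast : α.getLast? = β.getLast?) :
    IsEpsChain ε (l ++ β ++ r) := by
  refine ⟨by simp [hβ.1], ?_⟩
  have hchain := h.2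
  simp only [List.append_assoc, List.isChain_append, List.head?_append_of_ne_nil _ hα,
    List.head?_append_of_ne_nil _ hβ.1] at hchain ⊢
  rw [← hhead, ← hlast]
  exact ⟨hchain.1, ⟨hβ.2, hchain.2.1.2⟩, hchain.2.2⟩

theorem IsEpsChain.dist_lt (h : IsEpsChain ε (l ++ a :: b :: r)) : dist a b < ε :=
  (List.isChain_cons_cons.1 (List.isChain_append.1 h.2).2.1).1

instance : Std.Symm (BasicMove (X := X) ε) where
  symm _ _ h := ⟨h.2.1, h.1, h.2.2.1.symm, h.2.2.2.1.symm, h.2.2.2.2.symm⟩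

theorem BasicMove.congr (h : BasicMove ε α β) (hc : IsEpsChain ε (l ++ α ++ r)) :
    BasicMove ε (l ++ α ++ r) (l ++ β ++ r) := by
  obtain ⟨hα, hβ, hhead, hlast, hadd⟩ := h
  refine ⟨hc, hc.congr hα.1 hβ hhead hlast, ?_, ?_, hadd.imp (·.congr l r) (·.congr l r)⟩
  · simp only [List.append_assoc, List.head?_append, hhead]
  · simp only [List.append_assoc, List.getLast?_append, hlast]

theorem BasicMove.epsHomotopic (h : BasicMove ε α β) : EpsHomotopic ε α β := ⟨h.1, .single h⟩

namespace EpsHomotopic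

theorem refl (h : IsEpsChain ε α) : EpsHomotopic ε α α := ⟨h, .refl⟩

theorem trans (h : EpsHomotopic ε α β) (h' : EpsHomotopic ε β γ) : EpsHomotopic ε α γ :=
  ⟨h.1, h.2.trans h'.2⟩

theorem isEpsChain_right (h : EpsHomotopic ε α β) : IsEpsChain ε β := by
  obtain ⟨hα, h⟩ := h
  induction h with
  | refl => exact hα
  | tail _ hmove _ => exact hmove.2.1

theorem symm (h : EpsHomotopic ε α β) : EpsHomotopic ε β α :=
  ⟨h.isEpsChain_right, Std.Symm.symm _ _ h.2⟩

theorem head?_eq (h : EpsHomotopic ε α β) : α.head? = β.head? := by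
  obtain ⟨-, h⟩ := h
  induction h with
  | refl => rfl
  | tail _ hmove ih => exact ih.trans hmove.2.2.1

theorem congr (h : EpsHomotopic ε α β) (hc : IsEpsChain ε (l ++ α ++ r)) :
    EpsHomotopic ε (l ++ α ++ r) (l ++ β ++ r) := by
  obtain ⟨-, h⟩ := h
  induction h with
  | refl => exact refl hc
  | tail _ hmove ih => exact ih.trans (hmove.congr ih.isEpsChain_right).epsHomotopic

theorem replace (l r : List X) (h : EpsHomotopic ε γ (l ++ α ++ r)) (h' : EpsHomotopic ε α β) :
    EpsHomotopic ε γ (l ++ β ++ r) :=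
  h.trans (h'.congr h.isEpsChain_right)

theorem pair_triple (hab : dist a b < ε) (hax : dist a x < ε) (hxb : dist x b < ε) :
    EpsHomotopic ε [a, b] [a, x, b] :=
  BasicMove.epsHomotopic ⟨⟨by simp, by simp [hab]⟩, ⟨by simp, by simp [hax, hxb]⟩, rfl, rfl,
    .inl ⟨[a], [b], x, rfl, rfl⟩⟩

theorem singleton_pair (hε : 0 < ε) (a : X) : EpsHomotopic ε [a] [a, a] :=
  BasicMove.epsHomotopic ⟨⟨by simp, by simp⟩, ⟨by simp, by simp [hε]⟩, rfl, rfl,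
    .inl ⟨[], [a], a, rfl, rfl⟩⟩

theorem singleton_triple (hax : dist a x < ε) : EpsHomotopic ε [a] [a, x, a] :=
  have hε : 0 < ε := dist_nonneg.trans_lt hax
  (singleton_pair hε a).trans (pair_triple (by simpa using hε) hax (by rwa [dist_comm]))

theorem insert (l : List X) (h : EpsHomotopic ε γ (l ++ a :: b :: r)) (hax : dist a x < ε)
    (hxb : dist x b < ε) : EpsHomotopic ε γ (l ++ a :: x :: b :: r) := by
  have h' : EpsHomotopic ε γ (l ++ [a, b] ++ r) := by simpa using h
  simpa using h'.replace l r (pair_triple h.isEpsChain_right.dist_lt hax hxb)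

theorem remove (l : List X) (h : EpsHomotopic ε γ (l ++ a :: x :: b :: r)) (hab : dist a b < ε) :
    EpsHomotopic ε γ (l ++ a :: b :: r) := by
  have h' : EpsHomotopic ε γ (l ++ [a, x, b] ++ r) := by simpa using h
  have hax : dist a x < ε := h.isEpsChain_right.dist_lt
  have hxb : dist x b < ε := IsEpsChain.dist_lt (l := l ++ [a]) (r := r)
    (by simpa using h.isEpsChain_right)
  simpa using h'.replace l r (pair_triple hab hax hxb).symm

theorem move (l : List X) (h : EpsHomotopic ε γ (l ++ a :: x :: b :: r)) (hay : dist a y < ε)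
    (hxy : dist x y < ε) (hyb : dist y b < ε) : EpsHomotopic ε γ (l ++ a :: y :: b :: r) := by
  have h' : EpsHomotopic ε γ (l ++ [a] ++ x :: b :: r) := by simpa using h
  have h'' : EpsHomotopic ε γ (l ++ a :: x :: y :: b :: r) := by simpa using h'.insert _ hxy hyb
  exact h''.remove l hay

theorem backtrack (l : List X) (h : EpsHomotopic ε γ (l ++ a :: x :: a :: r)) :
    EpsHomotopic ε γ (l ++ a :: r) := by
  have h' : EpsHomotopic ε γ (l ++ [a, x, a] ++ r) := by simpa using h
  simpa using h'.replace l r (singleton_triple h.isEpsChain_right.dist_lt).symm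

end EpsHomotopic

theorem IsEpsNull.epsHomotopic_singleton (h : IsEpsNull ε (x :: α)) :
    EpsHomotopic ε (x :: α) [x] := by
  obtain ⟨y, hy⟩ := h
  obtain rfl : x = y := by simpa using hy.head?_eq
  exact hy

end Homotopy

section Midpoints

/-- The refinement of a chain which inserts the point `mid x y` between any `x` and its successor
`y`; fixing the choice of midpoints makes it a function of the chain. -/
def midpointRefine {X : Type*} (mid : X → X → X) : List X → List X
  | [] => []
  | [x] => [x]
  | x :: y :: l => x :: mid x y :: midpointRefine mid (y :: l)

variable {X : Type*} [MetricSpace X] {ε ℓ η : ℝ}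

/-- The metric notion of a midpoint `m` of `x` and `y` underlying `IsMidpointRefinement`; unlike in
an affine space, `x` and `y` do not determine `m`. -/
structure IsMetricMidpoint (x m y : X) : Prop where
  dist_left : dist x m = dist x y / 2
  dist_right : dist m y = dist x y / 2

theorem IsMetricMidpoint.symm {x m y : X} (h : IsMetricMidpoint x m y) : IsMetricMidpoint y m x :=
  ⟨by rw [dist_comm, h.dist_right, dist_comm x], by rw [dist_comm, h.dist_left, dist_comm x]⟩

theorem IsMetricMidpoint.eq {x m : X} (h : IsMetricMidpoint x m x) : m = x := by
  simpa using h.dist_right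

theorem IsGeodesicSpace.exists_dist_eq_mul (hX : IsGeodesicSpace X) (x y : X) {t : ℝ}
    (ht : t ∈ Set.Icc (0 : ℝ) 1) :
    ∃ z, dist x z = t * dist x y ∧ dist z y = (1 - t) * dist x y := by
  obtain ⟨γ, h0, h1, hγ⟩ := hX x y
  have hd : 0 ≤ dist x y := dist_nonneg
  have hmem : t * dist x y ∈ Set.Icc 0 (dist x y) :=
    ⟨mul_nonneg ht.1 hd, mul_le_of_le_one_left hd ht.2⟩
  refine ⟨γ (t * dist x y), ?_, ?_⟩
  · have h := hγ 0 ⟨le_rfl, hd⟩ _ hmem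
    rwa [h0, zero_sub, abs_neg, abs_of_nonneg hmem.1] at h
  · have h := hγ _ hmem _ ⟨hd, le_rfl⟩
    rw [h1, abs_sub_comm, abs_of_nonneg (sub_nonneg.2 hmem.2)] at h
    rw [h]
    ring

theorem IsGeodesicSpace.exists_isMetricMidpoint (hX : IsGeodesicSpace X) (x y : X) :
    ∃ m, IsMetricMidpoint x m y := by
  obtain ⟨m, hxm, hmy⟩ := hX.exists_dist_eq_mul x y (t := 1 / 2) (by norm_num)
  exact ⟨m, by linarith, by linarith⟩

namespace IsMidpointRefinement

variable {α β : List X}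

theorem exists_eq_cons {x : X} (h : IsMidpointRefinement (x :: α) β) : ∃ β', β = x :: β' := by
  cases h <;> exact ⟨_, rfl⟩

theorem getLast?_eq (h : IsMidpointRefinement α β) : β.getLast? = α.getLast? := by
  induction h with
  | single x => rfl
  | cons x m y α β _ _ h ih =>
    obtain ⟨β, rfl⟩ := h.exists_eq_cons
    simpa [List.getLast?_cons_cons] using ih

theorem isEpsChain (h : IsMidpointRefinement α β) (hα : α.IsChain (dist · · < 2 * ε)) :
    IsEpsChain ε β := by
  induction h with
  | single x => exact ⟨by simp, by simp⟩
  | cons x m y α β hxm hmy h ih =>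
    rw [List.isChain_cons_cons] at hα
    have hβ := ih hα.2
    obtain ⟨β, rfl⟩ := h.exists_eq_cons
    refine ⟨by simp, ?_⟩
    rw [List.isChain_cons_cons, List.isChain_cons_cons]
    exact ⟨by linarith, by linarith, hβ.2⟩

theorem epsHomotopic (h : IsMidpointRefinement α β) (hα : IsEpsChain ε α) :
    EpsHomotopic ε α β := by
  induction h with
  | single x => exact .refl hα
  | cons x m y α β hxm hmy h ih =>
    have hxy : dist x y < ε := hα.dist_lt (l := [])
    have ih := ih ⟨by simp, (List.isChain_cons_cons.1 hα.2).2⟩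
    have hd : 0 ≤ dist x y := dist_nonneg
    obtain ⟨β, rfl⟩ := h.exists_eq_cons
    have hxβ : EpsHomotopic ε (x :: y :: α) (x :: y :: β) := by
      simpa using EpsHomotopic.congr (l := [x]) (r := []) ih (by simpa using hα)
    exact hxβ.insert [] (by linarith) (by linarith)

end IsMidpointRefinement

theorem IsGeodesicSpace.epsHomotopic_segment (hX : IsGeodesicSpace X) (hε : 3 / 4 * ℓ + η ≤ ε)
    {x m y x' m' y' : X} (hm : IsMetricMidpoint x m y) (hm' : IsMetricMidpoint x' m' y')
    (hxy : dist x y ≤ ℓ) (hxy' : dist x' y' ≤ ℓ) (hx : dist x x' < η) (hy : dist y y' < η) :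
    EpsHomotopic ε [x, m, y] [x, x', m', y', y] := by
  -- The move from `m` to `m'` may be too long; it is made in two steps through `u`.
  obtain ⟨u, hu⟩ := hX.exists_isMetricMidpoint m' y'
  have hxm := hm.dist_left
  have hmy := hm.dist_right
  have hxm' := hm'.dist_left
  have hmy' := hm'.dist_right
  have hmu := hu.dist_left
  have huy' := hu.dist_right
  have hℓ : 0 ≤ dist x y := dist_nonneg
  have hη : 0 ≤ dist x x' := dist_nonneg
  have hyy' : dist y' y < η := by rwa [dist_comm]
  have hx'u : dist x' u ≤ 3 / 4 * ℓ := by linarith [dist_triangle x' m' u]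
  have hxu : dist x u < ε := by linarith [dist_triangle x x' u]
  have huy : dist u y < ε := by linarith [dist_triangle u y' y]
  have hmu' : dist m u < ε := by linarith [dist_triangle4 m y y' u, dist_comm y' u]
  have hum' : dist u m' < ε := by linarith [dist_comm u m']
  have h : EpsHomotopic ε [x, m, y] [x, m, y] :=
    .refl <| (IsMidpointRefinement.cons _ _ _ _ _ hxm hmy (.single y)).isEpsChain <| by
      simp only [List.isChain_cons_cons, List.isChain_singleton, and_true]
      linarith
  have h : EpsHomotopic ε [x, m, y] [x, u, y] := h.move [] hxu hmu' huy
  have h : EpsHomotopic ε [x, m, y] [x, x', u, y] := h.insert [] (by linarith) (by linarith)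
  have h : EpsHomotopic ε [x, m, y] [x, x', u, y', y] :=
    h.insert [x, x'] (by linarith) (by linarith)
  exact h.move [x] (by linarith) hum' (by linarith)

theorem IsMidpointRefinement.epsHomotopic_of_close (hX : IsGeodesicSpace X) (hℓ : 0 ≤ ℓ)
    (hε : 3 / 4 * ℓ + η ≤ ε) {α α' β β' : List X} (hne : α ≠ []) (hβ : IsMidpointRefinement α β)
    (hβ' : IsMidpointRefinement α' β') (hα : α.IsChain (dist · · ≤ ℓ))
    (hα' : α'.IsChain (dist · · ≤ ℓ)) (h : List.Forall₂ (dist · · < η) α α') :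
    EpsHomotopic ε β (α.head hne :: β' ++ [α.getLast hne]) := by
  induction hβ generalizing α' β' with
  | single x =>
    cases hβ' with
    | single x' =>
      have hx : dist x x' < η := by simpa using h
      exact .singleton_triple (by linarith)
    | cons => simp at h
  | cons x m y α β hxm hmy hβ ih =>
    cases hβ' with
    | single x' => simp at h
    | cons x' m' y' α' β' hxm' hmy' hβ' =>
      simp only [List.forall₂_cons] at h
      rw [List.isChain_cons_cons] at hα hα'
      obtain ⟨hx, hy, htail⟩ := h
      have hη : 0 < η := dist_nonneg.trans_lt hx
      have hchain : IsEpsChain ε (x :: m :: β) :=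
        (IsMidpointRefinement.cons x m y α β hxm hmy hβ).isEpsChain <|
          List.isChain_cons_cons.2 ⟨by linarith, hα.2.imp fun _ _ _ => by linarith⟩
      have ih := ih (by simp) hβ' hα.2 hα'.2 (by simp [hy, htail])
      have hseg := hX.epsHomotopic_segment hε ⟨hxm, hmy⟩ ⟨hxm', hmy'⟩ hα.1 hα'.1 hx hy
      obtain ⟨β', rfl⟩ := hβ'.exists_eq_cons
      have hleft : EpsHomotopic ε (x :: m :: β) ([x, m] ++ β ++ []) := by
        simpa using EpsHomotopic.refl hchain
      have hrest := hleft.replace [x, m] [] ih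
      have hswap := EpsHomotopic.replace [] (y' :: β' ++ [(y :: α).getLast (by simp)])
        (by simpa using hrest) hseg
      simpa using EpsHomotopic.backtrack [x, x', m'] hswap

theorem isMidpointRefinement_midpointRefine {mid : X → X → X}
    (hmid : ∀ x y, IsMetricMidpoint x (mid x y) y) {α : List X} (hα : α ≠ []) :
    IsMidpointRefinement α (midpointRefine mid α) := by
  induction α with
  | nil => exact absurd rfl hα
  | cons x α ih =>
    cases α with
    | nil => exact .single x
    | cons y α => exact .cons _ _ _ _ _ (hmid x y).dist_left (hmid x y).dist_right (ih (by simp))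

theorem IsGeodesicSpace.exists_isMidpointRefinement (hX : IsGeodesicSpace X) {α : List X}
    (hα : α ≠ []) : ∃ β, IsMidpointRefinement α β := by
  choose mid hmid using hX.exists_isMetricMidpoint
  exact ⟨_, isMidpointRefinement_midpointRefine hmid hα⟩

theorem isChain_triadLoop_iff {X : Type*} {T : X × X × X} {R : X → X → Prop} :
    (triadLoop T).IsChain R ↔ R T.1 T.2.1 ∧ R T.2.1 T.2.2 ∧ R T.2.2 T.1 := by
  simp [triadLoop]

end Midpoints

section Triangles

variable {X : Type*} [MetricSpace X] {ε ℓ η : ℝ} {T T' : X × X × X}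

/-- The longest side of a triangle given by its three vertices. -/
noncomputable def longestSide (T : X × X × X) : ℝ :=
  max (dist T.1 T.2.1) (max (dist T.2.1 T.2.2) (dist T.2.2 T.1))

theorem longestSide_le_iff :
    longestSide T ≤ ℓ ↔ dist T.1 T.2.1 ≤ ℓ ∧ dist T.2.1 T.2.2 ≤ ℓ ∧ dist T.2.2 T.1 ≤ ℓ := by
  simp only [longestSide, max_le_iff]

theorem longestSide_lt_iff :
    longestSide T < ℓ ↔ dist T.1 T.2.1 < ℓ ∧ dist T.2.1 T.2.2 < ℓ ∧ dist T.2.2 T.1 < ℓ := by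
  simp only [longestSide, max_lt_iff]

theorem continuous_longestSide : Continuous (longestSide : X × X × X → ℝ) := by
  unfold longestSide
  fun_prop

theorem IsTriad.longestSide_eq (h : IsTriad ε T) : longestSide T = ε := by
  simp [longestSide, h.2.1, h.2.2.1, dist_comm T.2.2, h.2.2.2]

/-- A triangle, given by its three vertices, is `ε`-null if all midpoint refinements of its boundary
are. Thus an essential triad is a triad which is not an `ε`-null triangle. -/
def IsNullTriangle (ε : ℝ) (T : X × X × X) : Prop :=
  ∀ α, IsMidpointRefinement (triadLoop T) α → IsEpsNull ε α

theorem isEssentialTriad_iff : IsEssentialTriad ε T ↔ IsTriad ε T ∧ ¬ IsNullTriangle ε T := by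
  simp only [IsEssentialTriad, IsNullTriangle, not_forall, exists_prop]

theorem epsHomotopic_refinement_triadLoop (hX : IsGeodesicSpace X) (hε : 3 / 4 * ℓ + η ≤ ε)
    (hT : longestSide T ≤ ℓ) (hT' : longestSide T' ≤ ℓ) (h : dist T T' < η) {β β' : List X}
    (hβ : IsMidpointRefinement (triadLoop T) β) (hβ' : IsMidpointRefinement (triadLoop T') β') :
    EpsHomotopic ε β (T.1 :: β' ++ [T.1]) := by
  simp only [Prod.dist_eq, max_lt_iff] at h
  have hℓ : 0 ≤ ℓ := dist_nonneg.trans (longestSide_le_iff.1 hT).1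
  exact hβ.epsHomotopic_of_close hX hℓ hε (by simp [triadLoop]) hβ'
    (isChain_triadLoop_iff.2 (longestSide_le_iff.1 hT))
    (isChain_triadLoop_iff.2 (longestSide_le_iff.1 hT'))
    (by simp only [triadLoop, List.forall₂_cons, h, List.Forall₂.nil, and_self])

theorem IsNullTriangle.of_dist_lt (hX : IsGeodesicSpace X) (hε : 3 / 4 * ℓ + η ≤ ε)
    (hnull : IsNullTriangle ε T') (hT : longestSide T ≤ ℓ) (hT' : longestSide T' ≤ ℓ)
    (h : dist T T' < η) : IsNullTriangle ε T := by
  intro β hβ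
  obtain ⟨β', hβ'⟩ := hX.exists_isMidpointRefinement (α := triadLoop T') (by simp [triadLoop])
  have hclose := epsHomotopic_refinement_triadLoop hX hε hT hT' h hβ hβ'
  have hβ'_null := hnull β' hβ'
  obtain ⟨β', rfl⟩ := hβ'.exists_eq_cons
  have hcontract : EpsHomotopic ε β [T.1, T'.1, T.1] :=
    EpsHomotopic.replace [T.1] [T.1] hclose hβ'_null.epsHomotopic_singleton
  exact ⟨T.1, hcontract.backtrack []⟩

theorem isNullTriangle_of_longestSide_lt (hT : longestSide T < ε) : IsNullTriangle ε T := by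
  intro β hβ
  have hloop : IsEpsChain ε (triadLoop T) :=
    ⟨by simp [triadLoop], isChain_triadLoop_iff.2 (longestSide_lt_iff.1 hT)⟩
  have hcut : EpsHomotopic ε β [T.1, T.2.2, T.1] :=
    (hβ.epsHomotopic hloop).symm.remove [] (by
      rw [dist_comm]
      exact (longestSide_lt_iff.1 hT).2.2)
  exact ⟨T.1, hcut.backtrack []⟩

theorem IsGeodesicSpace.exists_longestSide_lt (hX : IsGeodesicSpace X) {x y z : X}
    (h : longestSide (x, y, z) ≤ ε) (hxy : dist x y < ε) (hη : 0 < η) :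
    ∃ x' y', dist x x' < η ∧ dist y y' < η ∧ longestSide (x', y', z) < ε := by
  obtain ⟨-, hyz, hzx⟩ := longestSide_le_iff.1 h
  simp only at hyz hzx
  rw [dist_comm] at hzx
  have hε : 0 < ε := dist_nonneg.trans_lt hxy
  have hgap : 0 < ε - dist x y := sub_pos.2 hxy
  obtain ⟨t, ht, htη, htgap⟩ : ∃ t ∈ Set.Ioo (0 : ℝ) 1, t * ε < η ∧ 2 * (t * ε) < ε - dist x y := by
    have : 0 < min η (ε - dist x y) := lt_min hη hgap
    refine ⟨min η (ε - dist x y) / (3 * ε), ⟨by positivity, ?_⟩, ?_, ?_⟩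
    · rw [div_lt_one (by positivity)]
      linarith [min_le_right η (ε - dist x y), dist_nonneg (x := x) (y := y)]
    all_goals
      rw [← div_div, div_mul_cancel₀ _ hε.ne']
      linarith [min_le_left η (ε - dist x y), min_le_right η (ε - dist x y)]
  -- Move `x` and `y` a little towards `z`.
  have ht' : t ∈ Set.Icc (0 : ℝ) 1 := Set.Ioo_subset_Icc_self ht
  obtain ⟨x', hxx', hx'z⟩ := hX.exists_dist_eq_mul x z ht'
  obtain ⟨y', hyy', hy'z⟩ := hX.exists_dist_eq_mul y z ht'
  have hx_le : dist x x' ≤ t * ε := hxx' ▸ mul_le_mul_of_nonneg_left hzx ht.1.le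
  have hy_le : dist y y' ≤ t * ε := hyy' ▸ mul_le_mul_of_nonneg_left hyz ht.1.le
  have hshrink {d : ℝ} (hd : d ≤ ε) : (1 - t) * d < ε := by
    nlinarith [mul_le_mul_of_nonneg_left hd (sub_nonneg.2 ht.2.le), mul_pos ht.1 hε]
  refine ⟨x', y', hx_le.trans_lt htη, hy_le.trans_lt htη, longestSide_lt_iff.2 ⟨?_, ?_, ?_⟩⟩
  · have := dist_triangle4 x' x y y'
    rw [dist_comm x' x] at this
    simp only
    linarith
  · exact hy'z ▸ hshrink hyz
  · rw [dist_comm]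
    exact hx'z ▸ hshrink hzx

theorem IsGeodesicSpace.isTriad_or_exists_longestSide_lt (hX : IsGeodesicSpace X) (hε : 0 < ε)
    (hT : longestSide T ≤ ε) (hη : 0 < η) :
    IsTriad ε T ∨ ∃ T', dist T T' < η ∧ longestSide T' < ε := by
  obtain ⟨x, y, z⟩ := T
  obtain ⟨hxy, hyz, hzx⟩ := longestSide_le_iff.1 hT
  rcases hxy.lt_or_eq with hlt | hxy'
  · obtain ⟨x', y', hx, hy, h⟩ := hX.exists_longestSide_lt hT hlt hη
    exact .inr ⟨(x', y', z), by simp [Prod.dist_eq, *], h⟩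
  rcases hyz.lt_or_eq with hlt | hyz'
  · obtain ⟨y', z', hy, hz, h⟩ :=
      hX.exists_longestSide_lt (longestSide_le_iff.2 ⟨hyz, hzx, hxy⟩) hlt hη
    obtain ⟨hyz, hzx, hxy⟩ := longestSide_lt_iff.1 h
    exact .inr ⟨(x, y', z'), by simp [Prod.dist_eq, *], longestSide_lt_iff.2 ⟨hxy, hyz, hzx⟩⟩
  rcases hzx.lt_or_eq with hlt | hzx'
  · obtain ⟨z', x', hz, hx, h⟩ :=
      hX.exists_longestSide_lt (longestSide_le_iff.2 ⟨hzx, hxy, hyz⟩) hlt hη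
    obtain ⟨hzx, hxy, hyz⟩ := longestSide_lt_iff.1 h
    exact .inr ⟨(x', y, z'), by simp [Prod.dist_eq, *], longestSide_lt_iff.2 ⟨hxy, hyz, hzx⟩⟩
  exact .inl ⟨hε, hxy', hyz', by rwa [dist_comm] at hzx'⟩

theorem IsGeodesicSpace.isEssentialTriad (hX : IsGeodesicSpace X) (hε : 0 < ε)
    (hT : longestSide T ≤ ε) (hnull : ¬ IsNullTriangle ε T) : IsEssentialTriad ε T := by
  refine isEssentialTriad_iff.2 ⟨?_, hnull⟩
  refine (hX.isTriad_or_exists_longestSide_lt hε hT (show 0 < ε / 8 by positivity)).resolve_right ?_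
  rintro ⟨T', hdist, hT'⟩
  exact hnull ((isNullTriangle_of_longestSide_lt hT').of_dist_lt hX (by linarith) hT hT'.le hdist)

theorem isOpen_setOf_isNullTriangle (hX : IsGeodesicSpace X) (hε : 0 < ε) :
    IsOpen {T : X × X × X | longestSide T < 9 / 8 * ε ∧ IsNullTriangle ε T} := by
  refine isOpen_iff_mem_nhds.2 fun T ⟨hT, hnull⟩ => ?_
  filter_upwards [Metric.ball_mem_nhds T (show 0 < ε / 8 by positivity),
    continuous_longestSide.isOpen_preimage _ isOpen_Iio |>.mem_nhds hT] with T' hball hT'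
  exact ⟨hT', hnull.of_dist_lt hX (by linarith) (le_of_lt hT') hT.le hball⟩

end Triangles

section Refine

theorem exists_midpointRefine_append {X : Type*} (mid : X → X → X) (l : List X) (a : X) :
    ∃ l', ∀ r, midpointRefine mid (l ++ a :: r) = l' ++ midpointRefine mid (a :: r) := by
  induction l with
  | nil => exact ⟨[], fun r => rfl⟩
  | cons c l ih =>
    obtain ⟨l', hl'⟩ := ih
    cases l with
    | nil => exact ⟨[c, mid c a], fun r => rfl⟩
    | cons d l => exact ⟨c :: mid c d :: l', fun r => by simpa [midpointRefine] using hl' r⟩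

theorem exists_midpointRefine_cons {X : Type*} (mid : X → X → X) (x : X) (l : List X) :
    ∃ l', midpointRefine mid (x :: l) = x :: l' := by
  cases l <;> exact ⟨_, rfl⟩

theorem AddsPoint.eq_doubled_or_inserted {X : Type*} {α β : List X} (h : AddsPoint α β)
    (hα : α ≠ []) (hhead : α.head? = β.head?) (hlast : α.getLast? = β.getLast?) :
    (∃ l a r, α = l ++ a :: r ∧ β = l ++ a :: a :: r) ∨
      ∃ l a x b r, α = l ++ a :: b :: r ∧ β = l ++ a :: x :: b :: r := by
  obtain ⟨l, r, x, rfl, rfl⟩ := h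
  rcases l.eq_nil_or_concat' with rfl | ⟨l, a, rfl⟩
  · obtain ⟨b, r, rfl⟩ := List.exists_cons_of_ne_nil hα
    obtain rfl : b = x := by simpa using hhead
    exact .inl ⟨[], b, r, rfl, rfl⟩
  · cases r with
    | nil =>
      obtain rfl : a = x := by simpa using hlast
      exact .inl ⟨l, a, [], by simp, by simp⟩
    | cons b r => exact .inr ⟨l, a, x, b, r, by simp, by simp⟩

variable {X : Type*} [MetricSpace X] {ε δ : ℝ} {α β : List X} {mid : X → X → X}

theorem isEpsChain_midpointRefine (hmid : ∀ x y, IsMetricMidpoint x (mid x y) y)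
    (hδ : δ ≤ 2 * ε) (hα : IsEpsChain δ α) : IsEpsChain ε (midpointRefine mid α) :=
  (isMidpointRefinement_midpointRefine hmid hα.1).isEpsChain <|
    hα.2.imp fun _ _ h => h.trans_le hδ

theorem epsHomotopic_two_sides (hmid : ∀ x y, IsMetricMidpoint x (mid x y) y) {a x b : X}
    (hab : dist a b < 2 * ε) (hnull : IsNullTriangle ε (a, x, b)) :
    EpsHomotopic ε [a, mid a b, b] [a, mid a x, x, mid x b, b] := by
  have hm := hmid a b
  have hboundary : IsMidpointRefinement [a, x, b, a] [a, mid a x, x, mid x b, b, mid a b, a] :=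
    .cons _ _ _ _ _ (hmid a x).dist_left (hmid a x).dist_right <|
      .cons _ _ _ _ _ (hmid x b).dist_left (hmid x b).dist_right <|
        .cons _ _ _ _ _ hm.symm.dist_left hm.symm.dist_right (.single a)
  have hnull' := (hnull _ hboundary).epsHomotopic_singleton.symm
  have hside : EpsHomotopic ε [a, mid a b, b] [a, mid a b, b] :=
    .refl <| (IsMidpointRefinement.cons _ _ _ _ _ hm.dist_left hm.dist_right
      (.single b)).isEpsChain (by simpa using hab)
  have h : EpsHomotopic ε [a, mid a b, b]
      [a, mid a x, x, mid x b, b, mid a b, a, mid a b, b] :=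
    hside.replace [] [mid a b, b] hnull'
  have h : EpsHomotopic ε [a, mid a b, b] [a, mid a x, x, mid x b, b, mid a b, b] :=
    h.backtrack [a, mid a x, x, mid x b, b]
  exact h.backtrack [a, mid a x, x, mid x b]

theorem epsHomotopic_midpointRefine_of_addsPoint (hε : 0 < ε)
    (hmid : ∀ x y, IsMetricMidpoint x (mid x y) y) (hδ : δ ≤ 2 * ε)
    (hnull : ∀ T : X × X × X, longestSide T < δ → IsNullTriangle ε T) (hα : IsEpsChain δ α)
    (hβ : IsEpsChain δ β) (hhead : α.head? = β.head?) (hlast : α.getLast? = β.getLast?)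
    (hadd : AddsPoint α β) :
    EpsHomotopic ε (midpointRefine mid α) (midpointRefine mid β) := by
  have hrefl := EpsHomotopic.refl (isEpsChain_midpointRefine hmid hδ hα)
  rcases hadd.eq_doubled_or_inserted hα.1 hhead hlast with
    ⟨l, a, r, rfl, rfl⟩ | ⟨l, a, x, b, r, rfl, rfl⟩
  · obtain ⟨l', hl'⟩ := exists_midpointRefine_append mid l a
    obtain ⟨r', hr'⟩ := exists_midpointRefine_cons mid a r
    simp only [hl', midpointRefine, (hmid a a).eq, hr'] at hrefl ⊢
    simpa using EpsHomotopic.replace (α := [a]) l' r' (by simpa using hrefl)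
      (.singleton_triple (x := a) (by simpa using hε))
  · obtain ⟨l', hl'⟩ := exists_midpointRefine_append mid l a
    obtain ⟨r', hr'⟩ := exists_midpointRefine_cons mid b r
    have hab : dist a b < δ := hα.dist_lt
    have hax : dist a x < δ := hβ.dist_lt
    have hxb : dist x b < δ := IsEpsChain.dist_lt (l := l ++ [a]) (r := r) (by simpa using hβ)
    have htwo := epsHomotopic_two_sides hmid (hab.trans_le hδ) <|
      hnull (a, x, b) (longestSide_lt_iff.2 ⟨hax, hxb, by rwa [dist_comm]⟩)
    simp only [hl', midpointRefine, hr'] at hrefl ⊢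
    simpa using EpsHomotopic.replace l' r' (by simpa using hrefl) htwo

theorem EpsHomotopic.midpointRefine (hε : 0 < ε)
    (hmid : ∀ x y, IsMetricMidpoint x (mid x y) y) (hδ : δ ≤ 2 * ε)
    (hnull : ∀ T : X × X × X, longestSide T < δ → IsNullTriangle ε T) (h : EpsHomotopic δ α β) :
    EpsHomotopic ε (midpointRefine mid α) (midpointRefine mid β) := by
  obtain ⟨hα, h⟩ := h
  induction h with
  | refl => exact .refl (isEpsChain_midpointRefine hmid hδ hα)
  | tail _ hmove ih =>
    obtain ⟨h₁, h₂, hhead, hlast, hadd | hadd⟩ := hmove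
    · exact ih.trans
        (epsHomotopic_midpointRefine_of_addsPoint hε hmid hδ hnull h₁ h₂ hhead hlast hadd)
    · exact ih.trans (epsHomotopic_midpointRefine_of_addsPoint hε hmid hδ hnull h₂ h₁ hhead.symm
        hlast.symm hadd).symm

theorem IsEpsNull.of_isNullTriangle (hX : IsGeodesicSpace X) (hε : 0 < ε) (hδ : δ ≤ 2 * ε)
    (hnull : ∀ T : X × X × X, longestSide T < δ → IsNullTriangle ε T) (hα : IsEpsChain ε α)
    (h : IsEpsNull δ α) : IsEpsNull ε α := by
  choose mid hmid using hX.exists_isMetricMidpoint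
  obtain ⟨x, hx⟩ := h
  have hrefine := (isMidpointRefinement_midpointRefine hmid hα.1).epsHomotopic hα
  exact ⟨x, hrefine.trans (hx.midpointRefine hε hmid hδ hnull)⟩

end Refine

section EssentialTriads

theorem exists_gt_forall_lt_mem {K Y : Type*} [TopologicalSpace K] [CompactSpace K] [LinearOrder Y]
    [NoMaxOrder Y] [TopologicalSpace Y] [ClosedIicTopology Y] {f : K → Y} (hf : Continuous f)
    {U : Set K} (hU : IsOpen U) {c : Y} (h : ∀ x, f x ≤ c → x ∈ U) :
    ∃ d > c, ∀ x, f x < d → x ∈ U := by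
  rcases Uᶜ.eq_empty_or_nonempty with hempty | hne
  · obtain ⟨d, hd⟩ := exists_gt c
    exact ⟨d, hd, fun x _ => Set.compl_empty_iff.1 hempty ▸ Set.mem_univ x⟩
  · obtain ⟨x₀, hx₀, hmin⟩ := hU.isClosed_compl.isCompact.exists_isMinOn hne hf.continuousOn
    exact ⟨f x₀, not_le.1 fun hle => hx₀ (h x₀ hle),
      fun x hx => not_not.1 fun hxU => (hmin hxU).not_gt hx⟩

variable {X : Type*} [MetricSpace X] {ε ε' : ℝ} {T T' : X × X × X}

theorem exists_isEssentialTriad [CompactSpace X] (hX : IsGeodesicSpace X)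
    (hε : ε ∈ criticalSpectrum X) : ∃ T : X × X × X, IsEssentialTriad ε T := by
  obtain ⟨hpos, α, hloop, hnull, hcrit⟩ := hε
  by_contra! hnone
  have hsmall (T : X × X × X) (hT : longestSide T ≤ ε) :
      longestSide T < 9 / 8 * ε ∧ IsNullTriangle ε T :=
    ⟨by linarith, not_not.1 fun h => hnone T (hX.isEssentialTriad hpos hT h)⟩
  obtain ⟨δ, hδ, hlarger⟩ := exists_gt_forall_lt_mem continuous_longestSide
    (isOpen_setOf_isNullTriangle hX hpos) hsmall
  have hδ' : ε < min δ (2 * ε) := lt_min hδ (by linarith)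
  exact hnull <| IsEpsNull.of_isNullTriangle hX hpos (min_le_right δ (2 * ε))
    (fun T hT => (hlarger T (hT.trans_le (min_le_left _ _))).2) hloop.1 (hcrit _ hδ')

theorem one_le_multiplicity [CompactSpace X] (hX : IsGeodesicSpace X)
    (hε : ε ∈ criticalSpectrum X) : 1 ≤ multiplicity X ε := by
  obtain ⟨T, hT⟩ := exists_isEssentialTriad hX hε
  rw [← Set.encard_singleton T]
  exact le_iSup (fun S : {S : Set (X × X × X) // (∀ T ∈ S, IsEssentialTriad ε T) ∧
    S.Pairwise (fun T₁ T₂ => ¬ TriadEquiv ε T₁ T₂)} => S.1.encard)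
    ⟨{T}, by simpa using hT, Set.pairwise_singleton _ _⟩

theorem IsTriad.isEpsLoop (hT : IsTriad ε T) {β : List X}
    (hβ : IsMidpointRefinement (triadLoop T) β) : IsEpsLoop ε β := by
  have hchain : (triadLoop T).IsChain (dist · · < 2 * ε) :=
    isChain_triadLoop_iff.2 <| longestSide_lt_iff.1 <| by linarith [hT.longestSide_eq, hT.1]
  refine ⟨hβ.isEpsChain hchain, ?_⟩
  rw [hβ.getLast?_eq]
  obtain ⟨β', rfl⟩ := hβ.exists_eq_cons
  rfl

theorem triadEquiv_of_dist_lt (hX : IsGeodesicSpace X) (hT : IsTriad ε T) (hT' : IsTriad ε T')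
    (h : dist T T' < ε / 8) : TriadEquiv ε T T' := by
  obtain ⟨β, hβ⟩ := hX.exists_isMidpointRefinement (α := triadLoop T) (by simp [triadLoop])
  obtain ⟨β', hβ'⟩ := hX.exists_isMidpointRefinement (α := triadLoop T') (by simp [triadLoop])
  have hloop := hT.isEpsLoop hβ
  have hloop' := hT'.isEpsLoop hβ'
  have hclose : EpsHomotopic ε β (T.1 :: β' ++ [T.1]) :=
    epsHomotopic_refinement_triadLoop hX (by linarith [hT.1]) hT.longestSide_eq.le
      hT'.longestSide_eq.le h hβ hβ'
  have hfirst : dist T.1 T'.1 < ε := by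
    linarith [le_max_left (dist T.1 T'.1) (dist T.2 T'.2), Prod.dist_eq (x := T) (y := T'), hT.1]
  refine ⟨β, β', hβ, .inl hβ', hloop, hloop', [T.1], [T.1, T'.1], ?_⟩
  obtain ⟨β, rfl⟩ := hβ.exists_eq_cons
  obtain ⟨β', rfl⟩ := hβ'.exists_eq_cons
  exact ⟨⟨by simp, by simp⟩, ⟨by simp, by simp [hfirst]⟩, rfl, rfl, rfl,
    by simpa [concat] using hclose⟩

theorem IsEssentialTriad.le_of_dist_lt (hX : IsGeodesicSpace X) (hT : IsEssentialTriad ε T)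
    (hT' : IsTriad ε' T') (h : dist T T' < ε / 8) : ε ≤ ε' := by
  obtain ⟨htriad, hnull⟩ := isEssentialTriad_iff.1 hT
  refine not_lt.1 fun hlt => hnull ?_
  rw [← hT'.longestSide_eq] at hlt
  exact (isNullTriangle_of_longestSide_lt hlt).of_dist_lt hX (by linarith [htriad.1])
    htriad.longestSide_eq.le hlt.le h

end EssentialTriads

section Counting

/-- `X` can be partitioned into `n` (possibly empty) pieces, the fibres of `f`, in each of which any
two points have distance less than `r`. -/
def HasFinePartition (X : Type*) [PseudoMetricSpace X] (n : ℕ) (r : ℝ) : Prop :=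
  ∃ f : X → Fin n, ∀ p q, f p = f q → dist p q < r

namespace HasFinePartition

variable {m n : ℕ} {r s : ℝ}

theorem mono {X : Type*} [PseudoMetricSpace X] (h : HasFinePartition X n r) (hn : n ≤ m)
    (hr : r ≤ s) : HasFinePartition X m s := by
  obtain ⟨f, hf⟩ := h
  exact ⟨fun p => (f p).castLE hn,
    fun p q hpq => (hf p q (Fin.castLE_injective hn hpq)).trans_le hr⟩

theorem prod {X Y : Type*} [PseudoMetricSpace X] [PseudoMetricSpace Y]
    (hX : HasFinePartition X m r) (hY : HasFinePartition Y n r) :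
    HasFinePartition (X × Y) (m * n) r := by
  obtain ⟨f, hf⟩ := hX
  obtain ⟨g, hg⟩ := hY
  refine ⟨fun p => finProdFinEquiv (f p.1, g p.2), fun p q hpq => ?_⟩
  obtain ⟨hfpq, hgpq⟩ := Prod.mk.inj (finProdFinEquiv.injective hpq)
  exact max_lt (hf _ _ hfpq) (hg _ _ hgpq)

theorem of_ghDist_lt {X Y : Type*} [MetricSpace X] [CompactSpace X] [Nonempty X] [MetricSpace Y]
    [CompactSpace Y] [Nonempty Y] (hY : HasFinePartition Y n s)
    (h : GromovHausdorff.ghDist X Y < r) : HasFinePartition X n (s + 2 * r) := by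
  obtain ⟨f, hf⟩ := hY
  obtain ⟨Φ, Ψ, hΦ, hΨ, hdist⟩ := GromovHausdorff.ghDist_eq_hausdorffDist X Y
  have hfin : Metric.hausdorffEDist (Set.range Φ) (Set.range Ψ) ≠ ⊤ :=
    Metric.hausdorffEDist_ne_top_of_nonempty_of_bounded (Set.range_nonempty _)
      (Set.range_nonempty _) (isCompact_range hΦ.continuous).isBounded
      (isCompact_range hΨ.continuous).isBounded
  have hnear (p : X) : ∃ q : Y, dist (Φ p) (Ψ q) < r := by
    obtain ⟨_, ⟨q, rfl⟩, hq⟩ :=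
      Metric.exists_dist_lt_of_hausdorffDist_lt (Set.mem_range_self p) (hdist ▸ h) hfin
    exact ⟨q, hq⟩
  choose c hc using hnear
  refine ⟨fun p => f (c p), fun p q hpq => ?_⟩
  calc dist p q = dist (Φ p) (Φ q) := (hΦ.dist_eq p q).symm
    _ ≤ dist (Φ p) (Ψ (c p)) + dist (Ψ (c p)) (Ψ (c q)) + dist (Ψ (c q)) (Φ q) :=
        dist_triangle4 _ _ _ _
    _ < r + s + r := by
        rw [hΨ.dist_eq, dist_comm (Ψ (c q))]
        exact add_lt_add (add_lt_add (hc p) (hf _ _ hpq)) (hc q)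
    _ = s + 2 * r := by ring

end HasFinePartition

theorem exists_hasFinePartition (X : Type*) [PseudoMetricSpace X] [CompactSpace X] {r : ℝ}
    (hr : 0 < r) : ∃ n, HasFinePartition X n r := by
  obtain ⟨t, -, htf, ht⟩ := (isCompact_univ (X := X)).finite_cover_balls (half_pos hr)
  have hcover (p : X) : ∃ c : t, dist p c < r / 2 := by simpa using ht (Set.mem_univ p)
  choose c hc using hcover
  have := htf.fintype
  refine ⟨Fintype.card t, fun p => Fintype.equivFin t (c p), fun p q h => ?_⟩
  have hpq : c p = c q := (Fintype.equivFin t).injective h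
  have hp : dist p (c q) < r / 2 := hpq ▸ hc p
  linarith [dist_triangle_right p q (c q : X), hc q]

theorem IsGHPrecompact.exists_hasFinePartition {ι : Type*} {X : ι → Type*}
    [∀ i, MetricSpace (X i)] [∀ i, CompactSpace (X i)] [∀ i, Nonempty (X i)]
    (h : IsGHPrecompact X) {r : ℝ} (hr : 0 < r) : ∃ n, ∀ i, HasFinePartition (X i) n r := by
  obtain ⟨t, -, htf, ht⟩ := h.finite_cover_balls (show 0 < r / 4 by positivity)
  choose n hn using fun y : GromovHausdorff.GHSpace =>
    DiscreteHomotopy.exists_hasFinePartition y.Rep (half_pos hr)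
  obtain ⟨N, hN⟩ := (htf.image n).bddAbove
  refine ⟨N, fun i => ?_⟩
  obtain ⟨y, hy, hiy⟩ : ∃ y ∈ t, dist (GromovHausdorff.toGHSpace (X i)) y < r / 4 := by
    simpa using ht (subset_closure (Set.mem_range_self i))
  have hgh : GromovHausdorff.ghDist (X i) y.Rep < r / 4 := by
    rwa [GromovHausdorff.ghDist, y.toGHSpace_rep]
  exact ((hn y).of_ghDist_lt hgh).mono (hN (Set.mem_image_of_mem n hy)) (by linarith)

variable {X : Type*} [MetricSpace X] {a : ℝ} {n : ℕ}

theorem multiplicity_le_encard_image (hX : IsGeodesicSpace X) {ε : ℝ} {κ : Type*}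
    {g : X × X × X → κ} (hg : ∀ T T', g T = g T' → dist T T' < ε / 8) :
    multiplicity X ε ≤ (g '' {T | IsEssentialTriad ε T}).encard := by
  refine iSup_le fun ⟨S, hS, hpairwise⟩ => ?_
  have hinj : Set.InjOn g S := fun T hT T' hT' h => by
    by_contra hne
    exact hpairwise hT hT' hne (triadEquiv_of_dist_lt hX (hS T hT).1 (hS T' hT').1 (hg T T' h))
  rw [← hinj.encard_image]
  exact Set.encard_le_encard (Set.image_mono hS)

theorem disjoint_image_essentialTriads (hX : IsGeodesicSpace X) {ε ε' : ℝ} (hne : ε ≠ ε')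
    {κ : Type*} {g : X × X × X → κ} (hg : ∀ T T', g T = g T' → dist T T' < ε / 8)
    (hg' : ∀ T T', g T = g T' → dist T T' < ε' / 8) :
    Disjoint (g '' {T | IsEssentialTriad ε T}) (g '' {T | IsEssentialTriad ε' T}) := by
  refine Set.disjoint_left.2 ?_
  rintro _ ⟨T, hT, rfl⟩ ⟨T', hT', h⟩
  exact hne <| (hT.le_of_dist_lt hX hT'.1 (hg _ _ h.symm)).antisymm
    (hT'.le_of_dist_lt hX hT.1 (hg' _ _ h))

theorem criticalCount_le (hX : IsGeodesicSpace X) (h : HasFinePartition (X × X × X) n (a / 8)) :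
    criticalCount X a ≤ n := by
  obtain ⟨g, hg⟩ := h
  refine iSup_le fun ⟨F, hF⟩ => ?_
  have hclose {ε : ℝ} (hε : ε ∈ F) (T T' : X × X × X) (hT : g T = g T') : dist T T' < ε / 8 := by
    linarith [hg T T' hT, (hF ε hε).2]
  calc ∑ ε ∈ F, multiplicity X ε
      ≤ ∑ ε ∈ F, (g '' {T | IsEssentialTriad ε T}).encard :=
        Finset.sum_le_sum fun ε hε => multiplicity_le_encard_image hX (hclose hε)
    _ = (⋃ ε ∈ (F : Set ℝ), g '' {T | IsEssentialTriad ε T}).encard := by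
        rw [F.finite_toSet.encard_biUnion fun ε hε ε' hε' hne =>
          disjoint_image_essentialTriads hX hne (hclose hε) (hclose hε'), finsum_mem_coe_finset]
    _ ≤ (Set.univ : Set (Fin n)).encard := Set.encard_le_encard (Set.subset_univ _)
    _ = n := by simp

theorem IsGHPrecompact.exists_criticalCount_le {ι : Type*} {X : ι → Type*}
    [∀ i, MetricSpace (X i)] [∀ i, CompactSpace (X i)] [∀ i, Nonempty (X i)]
    (h : IsGHPrecompact X) (hX : ∀ i, IsGeodesicSpace (X i)) (ha : 0 < a) :
    ∃ N : ℕ, ∀ i, criticalCount (X i) a ≤ N := by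
  obtain ⟨n, hn⟩ := h.exists_hasFinePartition (show 0 < a / 8 by positivity)
  exact ⟨n * (n * n), fun i => criticalCount_le (hX i) ((hn i).prod ((hn i).prod (hn i)))⟩

theorem encard_le_criticalCount [CompactSpace X] (hX : IsGeodesicSpace X) :
    (criticalSpectrum X ∩ Set.Ioi a).encard ≤ criticalCount X a := by
  refine ENat.forall_natCast_le_iff_le.1 fun k hk => ?_
  obtain ⟨S, hS, hcard⟩ := Set.exists_subset_encard_eq hk
  have hfin : S.Finite := Set.finite_of_encard_eq_coe hcard
  lift S to Finset ℝ using hfin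
  rw [Set.encard_coe_eq_coe_finsetCard] at hcard
  calc (k : ℕ∞) = ∑ ε ∈ S, 1 := by simp [← hcard]
    _ ≤ ∑ ε ∈ S, multiplicity X ε :=
        Finset.sum_le_sum fun ε hε => one_le_multiplicity hX (hS hε).1
    _ ≤ criticalCount X a :=
        le_iSup (fun F : {F : Finset ℝ // ∀ ε ∈ F, ε ∈ criticalSpectrum X ∧ a < ε} =>
          ∑ ε ∈ F.1, multiplicity X ε) ⟨S, fun ε hε => hS hε⟩

theorem finite_criticalSpectrum_inter_Ioi [CompactSpace X] (hX : IsGeodesicSpace X) (ha : 0 < a) :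
    (criticalSpectrum X ∩ Set.Ioi a).Finite := by
  obtain ⟨n, hn⟩ := exists_hasFinePartition (X × X × X) (show 0 < a / 8 by positivity)
  exact Set.finite_of_encard_le_coe ((encard_le_criticalCount hX).trans (criticalCount_le hX hn))

theorem not_accPt_criticalSpectrum [CompactSpace X] (hX : IsGeodesicSpace X) {t : ℝ} (ht : 0 < t) :
    ¬ AccPt t (Filter.principal (criticalSpectrum X)) := by
  intro h
  have h' := h.nhds_inter (Ioi_mem_nhds (half_lt_self ht))
  rw [Set.inter_comm] at h'
  exact Set.Infinite.of_accPt h' (finite_criticalSpectrum_inter_Ioi hX (half_pos ht))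

end Counting

end DiscreteHomotopy

theorem theorem1p7 :
    (∀ (ι : Type*) (X : ι → Type*) [∀ i, MetricSpace (X i)] [∀ i, CompactSpace (X i)]
        [∀ i, Nonempty (X i)],
      (∀ i, DiscreteHomotopy.IsGeodesicSpace (X i)) → DiscreteHomotopy.IsGHPrecompact X →
      ∀ a : ℝ, 0 < a → ∃ N : ℕ, ∀ i, DiscreteHomotopy.criticalCount (X i) a ≤ (N : ℕ∞)) ∧
    (∀ (Y : Type*) [MetricSpace Y] [CompactSpace Y], DiscreteHomotopy.IsGeodesicSpace Y →
      (∀ ε ∈ DiscreteHomotopy.criticalSpectrum Y, 1 ≤ DiscreteHomotopy.multiplicity Y ε) ∧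
      ∀ t : ℝ, 0 < t → ¬ AccPt t (Filter.principal (DiscreteHomotopy.criticalSpectrum Y))) := by
  refine ⟨fun ι X _ _ _ hX h a ha => h.exists_criticalCount_le hX ha, fun Y _ _ hY => ⟨?_, ?_⟩⟩
  · exact fun ε hε => DiscreteHomotopy.one_le_multiplicity hY hε
  · exact fun t ht => DiscreteHomotopy.not_accPt_criticalSpectrum hY ht
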